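/- \textbf{Theorem (Conditions for informativity for uniform stabilization).} For symmetric real matrices, $\succeq 0$ and $\succ 0$ denote positive semidefiniteness and positive definiteness, and $M\prec M'$ means $M'-M\succ 0$. Let $n,m,T\in\mathbb N$, let $U_-\in\mathbb R^{m\times T}$ and $X=[x(0)\ \cdots\ x(T)]\in\mathbb R^{n\times(T+1)}$, and put $X_-=[x(0)\ \cdots\ x(T-1)]$, $X_+=[x(1)\ \cdots\ x(T)]$. Let $$\Pi=\begin{bmatrix}\Pi_{11}&\Pi_{12}\\ \Pi_{21}&\Pi_{22}\end{bmatrix}\in\mathbb R^{(n+T)\times(n+T)}$$ be symmetric, with $\Pi_{11}\in\mathbb R^{n\times n}$, $\Pi_{22}\in\mathbb R^{T\times T}$, $\Pi_{22}\prec 0$ and $\Pi_{11}-\Pi_{12}\Pi_{22}^{-1}\Pi_{21}\succeq 0$. Let $\Sigma(U_-,X)$ be the set of all systems consistent with the data, that is, of all pairs $(A,B)\in\mathbb R^{n\times n}\times\mathbb R^{n\times m}$ for which there is a $W_-\in\mathbb R^{n\times T}$ with $$X_+=AX_-+BU_-+W_-,\qquad \begin{bmatrix}I_n\\ W_-^\top\end{bmatrix}^\top\Pi\begin{bmatrix}I_n\\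 W_-^\top\end{bmatrix}\succeq 0 .$$ Assume that the data are generated by some true system $(\hat A,\hat B)\in\Sigma(U_-,X)$, and let $\lambda\in(0,1)$. Then the data $(U_-,X)$ are informative for uniform stabilization by state feedback with decay rate $\lambda$, that is, there exist $K\in\mathbb R^{m\times n}$ and $P\in\mathbb R^{n\times n}$ with $P\succ 0$ such that $$(A+BK)^\top P(A+BK)\prec\lambda P\qquad\text{for all }(A,B)\in\Sigma(U_-,X),\tag{1}$$ if and only if there exist $Q\in\mathbb R^{n\times n}$ with $Q\succ 0$, $L\in\mathbb R^{m\times n}$ and $\beta>0$ such that $$\begin{bmatrix}\lambda Q-\beta I_n&0&0&0\\0&0&0&Q\\0&0&0&L\\0&Q&L^\top&Q\end{bmatrix}-\begin{bmatrix}I_n&X_+\\0&-X_-\\0&-U_-\\0&0\end{bmatrix}\begin{bmatrix}\Pi_{11}&\Pi_{12}\\ \Pi_{21}&\Pi_{22}\end{bmatrix}\begin{bmatrix}I_n&X_+\\0&-X_-\\0&-U_-\\0&0\end{bmatrix}^\top\succeq 0.\tag{2}$$ Moreover, for all $Q\succ 0$, $L$ and $\beta>0$ that satisfy (2), the matrices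 $K:=LQ^{-1}$ and $P:=Q^{-1}\succ 0$ satisfy (1). -/

import Mathlib

open Matrix

namespace DataDriven

variable {n m T : ℕ}

/-- `X₋ = [x(0) ⋯ x(T-1)]`, from the state data `X = [x(0) ⋯ x(T)]`. -/
def statePast (X : Matrix (Fin n) (Fin (T + 1)) ℝ) : Matrix (Fin n) (Fin T) ℝ :=
  X.submatrix id Fin.castSucc

/-- `X₊ = [x(1) ⋯ x(T)]`, from the state data `X = [x(0) ⋯ x(T)]`. -/
def stateNext (X : Matrix (Fin n) (Fin (T + 1)) ℝ) : Matrix (Fin n) (Fin T) ℝ :=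
  X.submatrix id Fin.succ

/-- Standing assumptions on the matrix `Π` of the noise model: `Π` is symmetric, `Π₂₂ ≺ 0` and
`Π₁₁ - Π₁₂ Π₂₂⁻¹ Π₂₁ ⪰ 0`. -/
structure IsNoiseModel (Pm : Matrix (Fin n ⊕ Fin T) (Fin n ⊕ Fin T) ℝ) : Prop where
  symm : Pm.IsSymm
  neg : (-Pm.toBlocks₂₂).PosDef
  schur : (Pm.toBlocks₁₁ - Pm.toBlocks₁₂ * (Pm.toBlocks₂₂)⁻¹ * Pm.toBlocks₂₁).PosSemidef

/-- The noise `W₋ = [w(0) ⋯ w(T-1)]` satisfies `[I; W₋ᵀ]ᵀ Π [I; W₋ᵀ] ⪰ 0`. -/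
def SatisfiesNoiseModel (Pm : Matrix (Fin n ⊕ Fin T) (Fin n ⊕ Fin T) ℝ)
    (W : Matrix (Fin n) (Fin T) ℝ) : Prop :=
  ((fromRows (1 : Matrix (Fin n) (Fin n) ℝ) Wᵀ)ᵀ * Pm *
    fromRows (1 : Matrix (Fin n) (Fin n) ℝ) Wᵀ).PosSemidef

/-- The set `Σ(U₋, X)` of systems `(A, B)` consistent with the data. -/
def consistentSystems (Pm : Matrix (Fin n ⊕ Fin T) (Fin n ⊕ Fin T) ℝ)
    (U : Matrix (Fin m) (Fin T) ℝ) (X : Matrix (Fin n) (Fin (T + 1)) ℝ) :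
    Set (Matrix (Fin n) (Fin n) ℝ × Matrix (Fin n) (Fin m) ℝ) :=
  {S | ∃ W : Matrix (Fin n) (Fin T) ℝ, SatisfiesNoiseModel Pm W ∧
    stateNext X = S.1 * statePast X + S.2 * U + W}

/-- `(A + B K)ᵀ P (A + B K) ≺ lam P` for every system `(A, B)` consistent with the data. -/
def UniformlyStabilizes (Pm : Matrix (Fin n ⊕ Fin T) (Fin n ⊕ Fin T) ℝ)
    (U : Matrix (Fin m) (Fin T) ℝ) (X : Matrix (Fin n) (Fin (T + 1)) ℝ) (lam : ℝ)
    (K : Matrix (Fin m) (Fin n) ℝ) (P : Matrix (Fin n) (Fin n) ℝ) : Prop :=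
  ∀ (A : Matrix (Fin n) (Fin n) ℝ) (B : Matrix (Fin n) (Fin m) ℝ),
    (A, B) ∈ consistentSystems Pm U X →
      (lam • P - (A + B * K)ᵀ * P * (A + B * K)).PosDef

/-- The data `(U₋, X)` is informative for uniform stabilization by state feedback with decay
rate `lam`. -/
def InformativeForUniformStabilization (Pm : Matrix (Fin n ⊕ Fin T) (Fin n ⊕ Fin T) ℝ)
    (U : Matrix (Fin m) (Fin T) ℝ) (X : Matrix (Fin n) (Fin (T + 1)) ℝ) (lam : ℝ) : Prop :=
  ∃ (K : Matrix (Fin m) (Fin n) ℝ) (P : Matrix (Fin n) (Fin n) ℝ),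
    P.PosDef ∧ UniformlyStabilizes Pm U X lam K P

/-- The data matrix `[I X₊; 0 -X₋; 0 -U₋; 0 0]`, with block rows of sizes `n, n, m, n`. -/
def dataMatrix (U : Matrix (Fin m) (Fin T) ℝ) (X : Matrix (Fin n) (Fin (T + 1)) ℝ) :
    Matrix ((Fin n ⊕ (Fin n ⊕ Fin m)) ⊕ Fin n) (Fin n ⊕ Fin T) ℝ :=
  fromRows (fromBlocks 1 (stateNext X) 0 (fromRows (-statePast X) (-U))) 0

/-- The matrix `[lam Q - β I, 0, 0, 0; 0, 0, 0, Q; 0, 0, 0, L; 0, Q, Lᵀ, Q]`, with blocks of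
sizes `n, n, m, n`. -/
def designMatrix (lam β : ℝ) (Q : Matrix (Fin n) (Fin n) ℝ) (L : Matrix (Fin m) (Fin n) ℝ) :
    Matrix ((Fin n ⊕ (Fin n ⊕ Fin m)) ⊕ Fin n) ((Fin n ⊕ (Fin n ⊕ Fin m)) ⊕ Fin n) ℝ :=
  fromBlocks
    (fromBlocks (lam • Q - β • (1 : Matrix (Fin n) (Fin n) ℝ)) 0 0 0)
    (fromRows 0 (fromRows Q L))
    (fromCols 0 (fromCols Q Lᵀ))
    Q

/-- The linear matrix inequality in the unknowns `Q`, `L`, `β`. -/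
def SatisfiesLMI (Pm : Matrix (Fin n ⊕ Fin T) (Fin n ⊕ Fin T) ℝ)
    (U : Matrix (Fin m) (Fin T) ℝ) (X : Matrix (Fin n) (Fin (T + 1)) ℝ) (lam : ℝ)
    (Q : Matrix (Fin n) (Fin n) ℝ) (L : Matrix (Fin m) (Fin n) ℝ) (β : ℝ) : Prop :=
  (designMatrix lam β Q L - dataMatrix U X * Pm * (dataMatrix U X)ᵀ).PosSemidef

end DataDriven

/-!
Write `D = [X₋; U₋]`, `C = [I Kᵀ]` and `Q = P⁻¹`, and let `q` be the quadratic form of `Π`.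
A pair `(A, B)` is consistent with the data if and only if `q (ξ, X₊ᵀ ξ - Dᵀ y) ≥ 0` for all `ξ`,
where `y = [A B]ᵀ ξ`, and by duality of the Lyapunov inequality (`posDef_inv_of_posDef`) it is
stabilized if and only if `(C y)ᵀ Q (C y) < lam ξᵀ Q ξ` for all `ξ ≠ 0` and the same `y`. Completing
the square in the last block variable, the linear matrix inequality with `L = K Q` says that
`q (ξ, X₊ᵀ ξ - Dᵀ y) ≤ lam ξᵀ Q ξ - (C y)ᵀ Q (C y) - β ξᵀ ξ` for all `ξ` and `y`. Sufficiency
follows by inserting `y = [A B]ᵀ ξ` (`uniformlyStabilizes_of_satisfiesLMI`).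

Necessity is a matrix S-lemma, proved in three steps. First, `Dᵀ y = 0` implies `C y = 0`, as
otherwise the consistent closed loops would be unbounded (`mulVec_eq_zero_of_regressor`). So both
sides are quadratic forms in `ξ` and in `r`, which ranges over the image of `Dᵀ`, where the data
form is negative definite. Second, a pair `(ξ, r)` at which the data form is nonnegative comes from
a consistent system (`exists_linearMap_interpolating`), so the stabilization form is positive there
unless `(ξ, r) = 0`. Third, the strict S-lemma (`strict_S_lemma`) gives a multiplier `α > 0`, which
is normalized to `1` by scaling `Q`. The strict inequality makes a Slater condition unnecessary, so
the Schur complement of `Π` may be singular.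
-/

namespace DataDriven

/-! ### A strict S-lemma without a Slater condition -/

section SLemma

variable {V : Type*} [NormedAddCommGroup V] [NormedSpace ℝ V] [FiniteDimensional ℝ V]

theorem continuous_bilinForm_self (B : LinearMap.BilinForm ℝ V) : Continuous fun x => B x x := by
  have h : Continuous fun x : V => (LinearMap.toContinuousLinearMap : (V →ₗ[ℝ] ℝ) ≃ₗ[ℝ] _) (B x) :=
    LinearMap.continuous_of_finiteDimensional
      ((LinearMap.toContinuousLinearMap : (V →ₗ[ℝ] ℝ) ≃ₗ[ℝ] (V →L[ℝ] ℝ)).toLinearMap ∘ₗ B)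
  simpa using h.clm_apply continuous_id

/-- If a form `H` is nonpositive at `x` and at `y`, and `N` takes values of opposite signs there,
then some nonzero vector of the segment from `x` to `y` or to `-y` is isotropic for `N`, with `H`
still nonpositive. -/
theorem exists_isotropic_of_sign_change {N H : LinearMap.BilinForm ℝ V} (hH : H.IsSymm)
    {x y : V} (hx0 : x ≠ 0) (hNx : 0 ≤ N x x) (hNy : N y y < 0) (hHx : H x x ≤ 0)
    (hHy : H y y ≤ 0) : ∃ z, z ≠ 0 ∧ N z z = 0 ∧ H z z ≤ 0 := by
  -- replacing `y` by `-y` makes the cross term nonpositive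
  wlog hxy : H x y ≤ 0 generalizing y
  · exact this (y := -y) (by simpa using hNy) (by simpa using hHy) (by simp; linarith)
  have hcont : ContinuousOn
      (fun t : ℝ => N ((1 - t) • x + t • y) ((1 - t) • x + t • y)) (Set.Icc 0 1) :=
    ((continuous_bilinForm_self N).comp (by fun_prop)).continuousOn
  obtain ⟨t, ⟨ht0, ht1⟩, ht⟩ := intermediate_value_Icc' zero_le_one hcont
    (show (0 : ℝ) ∈ _ by simpa using ⟨hNy.le, hNx⟩)
  refine ⟨_, ?_, ht, ?_⟩
  · intro hz
    have hz' : (1 - t) • x = -(t • y) := eq_neg_of_add_eq_zero_left hz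
    have h2 : (1 - t) * ((1 - t) * N x x) = t * (t * N y y) := by
      have := congrArg (fun v => N v v) hz'
      simpa using this
    have ht' : t = 0 := by
      by_contra hne
      have h3 : 0 < t * t := by positivity
      nlinarith [mul_nonneg (mul_self_nonneg (1 - t)) hNx,
        mul_pos_of_neg_of_neg hNy (neg_neg_of_pos h3)]
    subst ht'
    exact hx0 (by simpa using hz')
  · have hs : H y x = H x y := by simpa using (hH.eq x y).symm
    simp only [map_add, map_smul, LinearMap.add_apply, LinearMap.smul_apply, smul_eq_mul, hs]
    have h1 : 0 ≤ 1 - t := by linarith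
    nlinarith [mul_nonneg (mul_nonneg h1 h1) (neg_nonneg.2 hHx),
      mul_nonneg (mul_nonneg ht0 ht0) (neg_nonneg.2 hHy),
      mul_nonneg (mul_nonneg h1 ht0) (neg_nonneg.2 hxy)]

/-- The strict S-lemma: if `M` is positive on the nonzero vectors where `N` is nonnegative, then
`M - α N` is positive definite for some `α > 0`. Strictness replaces the Slater condition. If every
member of the pencil `s M - (1 - s) N`, `0 < s < 1`, failed to be positive, then by connectedness of
`[0, 1]` some member would fail both at a vector with `0 ≤ N` and at one with `M ≤ 0`, hence at a
nonzero isotropic vector of `N`, which is impossible. -/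
theorem strict_S_lemma {M N : LinearMap.BilinForm ℝ V} (hM : M.IsSymm) (hN : N.IsSymm)
    (h : ∀ x, x ≠ 0 → 0 ≤ N x x → 0 < M x x) :
    ∃ α : ℝ, 0 < α ∧ ∃ c : ℝ, 0 < c ∧ ∀ x, c * ‖x‖ ^ 2 ≤ M x x - α * N x x := by
  have hMc := continuous_bilinForm_self M
  have hNc := continuous_bilinForm_self N
  have hne : ∀ {x : V}, ‖x‖ = 1 → x ≠ 0 := fun hx => norm_ne_zero_iff.1 (by simp [hx])
  -- it suffices to find one pencil member that is positive on the unit sphere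
  suffices hs : ∃ s ∈ Set.Ioo (0 : ℝ) 1, ∀ x : V, ‖x‖ = 1 → 0 < s * M x x - (1 - s) * N x x by
    obtain ⟨s, ⟨hs0, hs1⟩, hs⟩ := hs
    have hα : 0 < (1 - s) / s := div_pos (by linarith) hs0
    refine ⟨(1 - s) / s, hα, ?_⟩
    obtain ⟨c, hc, hcx⟩ := (isCompact_sphere (0 : V) 1).exists_forall_le'
      (f := fun x => M x x - (1 - s) / s * N x x) (a := 0)
      (hMc.sub (continuous_const.mul hNc)).continuousOn (fun x hx => by
        have h1 := hs x (by simpa using hx)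
        have h2 : M x x - (1 - s) / s * N x x = (s * M x x - (1 - s) * N x x) / s := by
          field_simp
        rw [h2]; exact div_pos h1 hs0)
    refine ⟨c, hc, fun x => ?_⟩
    rcases eq_or_ne x 0 with rfl | hx
    · simp
    have hx' : 0 < ‖x‖ := norm_pos_iff.2 hx
    have h1 := hcx (‖x‖⁻¹ • x) (by simp [norm_smul, hx'.ne'])
    simp only [map_smul, LinearMap.smul_apply, smul_eq_mul] at h1
    have h2 : ‖x‖⁻¹ * (‖x‖⁻¹ * M x x) - (1 - s) / s * (‖x‖⁻¹ * (‖x‖⁻¹ * N x x))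
        = (M x x - (1 - s) / s * N x x) / ‖x‖ ^ 2 := by field_simp
    rw [h2, le_div_iff₀ (by positivity)] at h1
    exact h1
  by_contra! hcon
  -- Parameters `s` at which the pencil fails to be positive, split by the sign of `N` or `M` at
  -- the witness.
  let F : (V → Prop) → Set ℝ := fun p =>
    {s | s ∈ Set.Icc (0 : ℝ) 1 ∧ ∃ x : V, ‖x‖ = 1 ∧ s * M x x - (1 - s) * N x x ≤ 0 ∧ p x}
  have hF : ∀ p : V → Prop, IsClosed {x | p x} → IsClosed (F p) := by
    intro p hp
    have hcl : IsClosed {q : ℝ × V | q.1 * M q.2 q.2 - (1 - q.1) * N q.2 q.2 ≤ 0} :=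
      isClosed_le ((continuous_fst.mul (hMc.comp continuous_snd)).sub
        ((continuous_const.sub continuous_fst).mul (hNc.comp continuous_snd))) continuous_const
    have hK := ((isCompact_Icc (a := (0 : ℝ)) (b := 1)).prod
      (isCompact_sphere (0 : V) 1)).inter_right (hcl.inter (hp.preimage continuous_snd))
    convert (hK.image continuous_fst).isClosed using 1
    ext s
    simp only [F, Set.mem_ofPred_eq, Set.mem_image, Set.mem_inter_iff, Set.mem_prod,
      Set.mem_preimage, Prod.exists, mem_sphere_zero_iff_norm]
    constructor
    · rintro ⟨h1, x, h2, h3⟩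
      exact ⟨s, x, ⟨⟨h1, h2⟩, h3⟩, rfl⟩
    · rintro ⟨s, x, ⟨⟨h1, h2⟩, h3⟩, rfl⟩
      exact ⟨h1, x, h2, h3⟩
  have hP := hF (fun x => 0 ≤ N x x) (isClosed_le continuous_const hNc)
  have hQ := hF (fun x => M x x ≤ 0) (isClosed_le hMc continuous_const)
  have hcov : Set.Icc (0 : ℝ) 1 ⊆ F (fun x => 0 ≤ N x x) ∪ F (fun x => M x x ≤ 0) := by
    rw [← closure_Ioo zero_ne_one]
    refine closure_minimal (fun s hs => ?_) (hP.union hQ)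
    obtain ⟨x, hx, hle⟩ := hcon s hs
    rcases le_or_gt 0 (N x x) with h1 | h1
    · exact Or.inl ⟨Set.Ioo_subset_Icc_self hs, x, hx, hle, h1⟩
    · refine Or.inr ⟨Set.Ioo_subset_Icc_self hs, x, hx, hle, ?_⟩
      by_contra! h2
      nlinarith [mul_pos hs.1 h2, mul_pos (sub_pos.2 hs.2) (neg_pos.2 h1)]
  have h0 : (0 : ℝ) ∈ F (fun x => 0 ≤ N x x) := by
    refine (hcov (by simp)).resolve_right ?_
    rintro ⟨-, x, hx, hle, hMx⟩
    exact absurd (h x (hne hx) (by simpa using hle)) hMx.not_gt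
  have h1 : (1 : ℝ) ∈ F (fun x => M x x ≤ 0) := by
    refine (hcov (by simp)).resolve_left ?_
    rintro ⟨-, x, hx, hle, hNx⟩
    exact absurd (h x (hne hx) hNx) (by simpa using hle)
  obtain ⟨s, hs, ⟨-, x, hx, hHx, hNx⟩, -, y, hy, hHy, hMy⟩ :=
    isPreconnected_closed_iff.1 isPreconnected_Icc _ _ hP hQ hcov
      ⟨0, by simp, h0⟩ ⟨1, by simp, h1⟩
  have hNy : N y y < 0 := by
    by_contra! h2
    exact absurd (h y (hne hy) h2) hMy.not_gt
  have hs0 : 0 < s := by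
    refine hs.1.lt_of_ne ?_
    rintro rfl
    simp only [zero_mul, sub_zero, one_mul, zero_sub] at hHy
    linarith
  have hsymm : (s • M - (1 - s) • N).IsSymm := (hM.smul s).sub (hN.smul (1 - s))
  obtain ⟨z, hz0, hNz, hHz⟩ := exists_isotropic_of_sign_change hsymm (hne hx) hNx hNy
    (by simpa using hHx) (by simpa using hHy)
  have hMz := h z hz0 hNz.ge
  have : s * M z z ≤ 0 := by simpa [hNz] using hHz
  nlinarith [mul_pos hs0 hMz]

end SLemma

/-! ### Interpolation by a linear map in the nonnegativity set of a form -/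

/-- Every point `(x, r)` at which `B` is nonnegative lies on the graph of a linear map on which `B`
is nonnegative. Over each `y`, the `s` with `B (y, s) (y, s) ≥ 0` form an ellipsoid with center
`Z y` and squared radius `S y y`; the map is `Z` plus a rank-one correction, which stays in the
ellipsoids by Cauchy-Schwarz for `S`. -/
theorem exists_linearMap_interpolating {V R : Type*} [AddCommGroup V] [Module ℝ V]
    [AddCommGroup R] [Module ℝ R] [FiniteDimensional ℝ R] {B : LinearMap.BilinForm ℝ (V × R)}
    (hB : B.IsSymm) (hpos : ∀ x, 0 ≤ B (x, 0) (x, 0)) (hneg : ∀ r, r ≠ 0 → B (0, r) (0, r) < 0)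
    {x : V} {r : R} (hxr : 0 ≤ B (x, r) (x, r)) :
    ∃ h : V →ₗ[ℝ] R, h x = r ∧ ∀ y, 0 ≤ B (y, h y) (y, h y) := by
  let g : LinearMap.BilinForm ℝ R := -B.compl₁₂ (LinearMap.inr ℝ V R) (LinearMap.inr ℝ V R)
  have hg : ∀ r s, g r s = -B (0, r) (0, s) := fun r s => by simp [g]
  have hgsymm : ∀ r s, g r s = g s r := fun r s => by rw [hg, hg, hB.eq]
  have hgpos : ∀ r, 0 ≤ g r r := fun r => by
    rcases eq_or_ne r 0 with rfl | hr
    · simp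
    · rw [hg]; linarith [hneg r hr]
  have hgnd : g.Nondegenerate := by
    have h0 : ∀ r, g r r = 0 → r = 0 := fun r h => by
      by_contra hr
      have := hneg r hr
      rw [hg] at h
      linarith
    exact ⟨fun r hr => h0 r (hr r), fun r hr => h0 r (hr r)⟩
  -- the center of the ellipsoid of admissible `r` over `y` depends linearly on `y`
  let Z : V →ₗ[ℝ] R := (g.toDual hgnd).symm.toLinearMap ∘ₗ
    B.compl₁₂ (LinearMap.inl ℝ V R) (LinearMap.inr ℝ V R)
  have hZ : ∀ y s, g (Z y) s = B (y, 0) (0, s) := fun y s => by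
    simp [Z, LinearMap.BilinForm.apply_toDual_symm_apply]
  let S : LinearMap.BilinForm ℝ V :=
    B.compl₁₂ (LinearMap.inl ℝ V R) (LinearMap.inl ℝ V R) + g.compl₁₂ Z Z
  have hS : ∀ y z, S y z = B (y, 0) (z, 0) + g (Z y) (Z z) := fun y z => by simp [S]
  have hSsymm : S.IsSymm := ⟨fun y z => by
    rw [hS, hS, ← hB.eq, hgsymm]⟩
  have hSpos : ∀ y, 0 ≤ S y y := fun y => by
    rw [hS]; exact add_nonneg (hpos y) (hgpos _)
  -- completion of the square
  have hsq : ∀ y s, B (y, s) (y, s) = S y y - g (s - Z y) (s - Z y) := fun y s => by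
    have e : ((y, s) : V × R) = (y, 0) + (0, s) := by simp
    have e1 : B (0, s) (y, 0) = B (y, 0) (0, s) := by rw [← hB.eq]
    rw [e, hS]
    simp only [map_add, map_sub, LinearMap.add_apply, LinearMap.sub_apply, e1, hZ, hgsymm s (Z y)]
    rw [hg s s]; ring
  rcases (hSpos x).eq_or_lt with h0 | h0
  · refine ⟨Z, ?_, fun y => by rw [hsq]; simpa using hSpos y⟩
    by_contra hne
    have h1 := hneg (r - Z x) (sub_ne_zero.2 (Ne.symm hne))
    have h2 := hg (r - Z x) (r - Z x)
    have h3 := hsq x r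
    linarith
  · refine ⟨Z + (S x).smulRight ((S x x)⁻¹ • (r - Z x)), ?_, fun y => ?_⟩
    · simp [smul_smul, h0.ne']
    · rw [hsq]
      have hcs := S.apply_sq_le_of_symm hSpos ⟨fun y z => hSsymm.eq y z⟩ x y
      have h1 := hsq x r
      set p := g (r - Z x) (r - Z x) with hp
      have e : (Z + (S x).smulRight ((S x x)⁻¹ • (r - Z x))) y - Z y
          = (S x y * (S x x)⁻¹) • (r - Z x) := by simp [smul_smul]
      rw [e]
      simp only [map_smul, LinearMap.smul_apply, smul_eq_mul, ← hp]
      have h2 : S x y * (S x x)⁻¹ * (S x y * (S x x)⁻¹ * p) = S x y ^ 2 * p / S x x ^ 2 := by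
        field_simp
      rw [h2, sub_nonneg, div_le_iff₀ (by positivity)]
      have h3 : p ≤ S x x := by linarith
      nlinarith [mul_le_mul_of_nonneg_left h3 (sq_nonneg (S x y)),
        mul_le_mul_of_nonneg_right hcs h0.le]

/-! ### Quadratic forms of real matrices -/

section QuadraticForms

variable {ι κ : Type*} [Fintype κ]

theorem isSymm_mul_mul_transpose (A : Matrix ι κ ℝ) {B : Matrix κ κ ℝ} (hB : B.IsSymm) :
    (A * B * Aᵀ).IsSymm := by
  simp [IsSymm, transpose_mul, hB.eq, Matrix.mul_assoc]

theorem isSymm_of_isHermitian {A : Matrix ι ι ℝ} (hA : A.IsHermitian) : A.IsSymm := by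
  rw [IsSymm, ← conjTranspose_eq_transpose_of_trivial]
  exact hA

variable [Fintype ι]

theorem dotProduct_mulVec_comm {A : Matrix ι ι ℝ} (hA : A.IsSymm) (x y : ι → ℝ) :
    x ⬝ᵥ A *ᵥ y = y ⬝ᵥ A *ᵥ x := by
  rw [← dotProduct_transpose_mulVec, hA.eq]

theorem dotProduct_mul_mul_transpose_mulVec (A : Matrix ι κ ℝ) (B : Matrix κ κ ℝ) (x : ι → ℝ) :
    x ⬝ᵥ (A * B * Aᵀ) *ᵥ x = (Aᵀ *ᵥ x) ⬝ᵥ B *ᵥ (Aᵀ *ᵥ x) := by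
  rw [← mulVec_mulVec, ← mulVec_mulVec, dotProduct_mulVec, ← mulVec_transpose]

theorem posSemidef_iff_forall {A : Matrix ι ι ℝ} (hA : A.IsSymm) :
    A.PosSemidef ↔ ∀ x, 0 ≤ x ⬝ᵥ A *ᵥ x := by
  rw [posSemidef_iff_dotProduct_mulVec]
  simp [IsHermitian, conjTranspose_eq_transpose_of_trivial, hA.eq]

theorem posDef_iff_forall {A : Matrix ι ι ℝ} (hA : A.IsSymm) :
    A.PosDef ↔ ∀ x, x ≠ 0 → 0 < x ⬝ᵥ A *ᵥ x := by
  rw [posDef_iff_dotProduct_mulVec]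
  simp [IsHermitian, conjTranspose_eq_transpose_of_trivial, hA.eq]

theorem posDef_smul_sub_iff {Q A : Matrix ι ι ℝ} (hQ : Q.IsSymm) (lam : ℝ) :
    (lam • Q - A * Q * Aᵀ).PosDef ↔
      ∀ x, x ≠ 0 → (Aᵀ *ᵥ x) ⬝ᵥ Q *ᵥ (Aᵀ *ᵥ x) < lam * (x ⬝ᵥ Q *ᵥ x) := by
  rw [posDef_iff_forall ((hQ.smul lam).sub (isSymm_mul_mul_transpose A hQ))]
  refine forall₂_congr fun x _ => ?_
  rw [sub_mulVec, dotProduct_sub, dotProduct_mul_mul_transpose_mulVec, smul_mulVec,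
    dotProduct_smul, smul_eq_mul, sub_pos]

variable [DecidableEq ι]

theorem toBilin'_isSymm {A : Matrix ι ι ℝ} (hA : A.IsSymm) : (toBilin' A).IsSymm :=
  ⟨fun x y => by simpa [toBilin'_apply'] using dotProduct_mulVec_comm hA x y⟩

/-- Duality of the Lyapunov inequality: the quadratic form of `Q⁻¹` contracts along `A` if that of
`Q` contracts along `Aᵀ`. -/
theorem posDef_inv_of_posDef {Q A : Matrix ι ι ℝ} (hQ : Q.PosDef) {lam : ℝ} (hlam : 0 < lam)
    (h : (lam • Q - A * Q * Aᵀ).PosDef) : (lam • Q⁻¹ - Aᵀ * Q⁻¹ * A).PosDef := by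
  have hQs := isSymm_of_isHermitian hQ.1
  have hPs := isSymm_of_isHermitian hQ.inv.1
  have hu : IsUnit Q.det := (isUnit_iff_isUnit_det _).1 hQ.isUnit
  have hPQ : ∀ v, Q⁻¹ *ᵥ (Q *ᵥ v) = v := fun v => by
    rw [mulVec_mulVec, nonsing_inv_mul _ hu, one_mulVec]
  have hQP : ∀ v, Q *ᵥ (Q⁻¹ *ᵥ v) = v := fun v => by
    rw [mulVec_mulVec, mul_nonsing_inv _ hu, one_mulVec]
  rw [posDef_smul_sub_iff hQs] at h
  have key := posDef_smul_sub_iff (A := Aᵀ) hPs lam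
  rw [transpose_transpose] at key
  rw [key]
  have hpos := (posDef_iff_forall hPs).1 hQ.inv
  intro x hx
  have hPx := mul_pos hlam (hpos x hx)
  rcases eq_or_ne (A *ᵥ x) 0 with h0 | h0
  · simpa [h0] using hPx
  have hp := hpos _ h0
  set ξ := Q⁻¹ *ᵥ (A *ᵥ x) with hξ
  have hξ0 : ξ ≠ 0 := fun h1 => by
    rw [hξ] at h1
    have := hQP (A *ᵥ x)
    rw [h1, mulVec_zero] at this
    exact h0 this.symm
  have h1 := h ξ hξ0
  have h2 : ξ ⬝ᵥ Q *ᵥ ξ = (A *ᵥ x) ⬝ᵥ ξ := by rw [hξ, hQP, dotProduct_comm]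
  -- Cauchy-Schwarz for `Q⁻¹`, applied to `x` and `Q Aᵀ ξ`
  have hcs := (toBilin' Q⁻¹).apply_sq_le_of_symm
    (fun y => by rw [toBilin'_apply']; exact (posSemidef_iff_forall hPs).1 hQ.inv.posSemidef y)
    ⟨fun y z => (toBilin'_isSymm hPs).eq y z⟩ x (Q *ᵥ (Aᵀ *ᵥ ξ))
  simp only [toBilin'_apply', hPQ] at hcs
  have h3 : x ⬝ᵥ (Aᵀ *ᵥ ξ) = (A *ᵥ x) ⬝ᵥ ξ := by
    rw [dotProduct_mulVec, vecMul_transpose]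
  rw [h3, dotProduct_comm (Q *ᵥ _)] at hcs
  rw [h2] at h1
  have hxx := hpos x hx
  nlinarith [mul_lt_mul_of_pos_left h1 hxx]

end QuadraticForms

/-! ### Consistent systems and the linear matrix inequality as statements about vectors -/

variable {n m T : ℕ}

/-- The data matrix `[X₋; U₋]`, which multiplies `[A B]` in the system equation. -/
def regressor (U : Matrix (Fin m) (Fin T) ℝ) (X : Matrix (Fin n) (Fin (T + 1)) ℝ) :
    Matrix (Fin n ⊕ Fin m) (Fin T) ℝ :=
  fromRows (statePast X) U

theorem satisfiesNoiseModel_iff {Pm : Matrix (Fin n ⊕ Fin T) (Fin n ⊕ Fin T) ℝ} (hPm : Pm.IsSymm)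
    (W : Matrix (Fin n) (Fin T) ℝ) :
    SatisfiesNoiseModel Pm W ↔
      ∀ ξ, 0 ≤ Sum.elim ξ (Wᵀ *ᵥ ξ) ⬝ᵥ Pm *ᵥ Sum.elim ξ (Wᵀ *ᵥ ξ) := by
  have hs := isSymm_mul_mul_transpose (fromRows (1 : Matrix (Fin n) (Fin n) ℝ) Wᵀ)ᵀ hPm
  rw [transpose_transpose] at hs
  rw [SatisfiesNoiseModel, posSemidef_iff_forall hs]
  refine forall_congr' fun ξ => ?_
  have := dotProduct_mul_mul_transpose_mulVec (fromRows (1 : Matrix (Fin n) (Fin n) ℝ) Wᵀ)ᵀ Pm ξ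
  rw [transpose_transpose] at this
  rw [this, fromRows_mulVec, one_mulVec]

theorem mem_consistentSystems_iff {Pm : Matrix (Fin n ⊕ Fin T) (Fin n ⊕ Fin T) ℝ}
    (hPm : Pm.IsSymm) {U : Matrix (Fin m) (Fin T) ℝ} {X : Matrix (Fin n) (Fin (T + 1)) ℝ}
    {A : Matrix (Fin n) (Fin n) ℝ} {B : Matrix (Fin n) (Fin m) ℝ} :
    (A, B) ∈ consistentSystems Pm U X ↔
      ∀ ξ, 0 ≤ Sum.elim ξ ((stateNext X)ᵀ *ᵥ ξ - (regressor U X)ᵀ *ᵥ ((fromCols A B)ᵀ *ᵥ ξ)) ⬝ᵥ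
        Pm *ᵥ Sum.elim ξ
          ((stateNext X)ᵀ *ᵥ ξ - (regressor U X)ᵀ *ᵥ ((fromCols A B)ᵀ *ᵥ ξ)) := by
  have h1 : (A, B) ∈ consistentSystems Pm U X ↔
      SatisfiesNoiseModel Pm (stateNext X - fromCols A B * regressor U X) := by
    rw [regressor, fromCols_mul_fromRows]
    constructor
    · rintro ⟨W, hW, h⟩
      simp only at h
      rwa [h, add_sub_cancel_left]
    · exact fun h => ⟨_, h, by simp⟩
  rw [h1, satisfiesNoiseModel_iff hPm]
  simp only [transpose_sub, transpose_mul, sub_mulVec, mulVec_mulVec]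

theorem satisfiesLMI_iff {Pm : Matrix (Fin n ⊕ Fin T) (Fin n ⊕ Fin T) ℝ} (hPm : Pm.IsSymm)
    (U : Matrix (Fin m) (Fin T) ℝ) (X : Matrix (Fin n) (Fin (T + 1)) ℝ) (lam β : ℝ)
    {Q : Matrix (Fin n) (Fin n) ℝ} (hQ : Q.IsSymm) (L : Matrix (Fin m) (Fin n) ℝ) :
    SatisfiesLMI Pm U X lam Q L β ↔ ∀ ξ y z,
      Sum.elim ξ ((stateNext X)ᵀ *ᵥ ξ - (regressor U X)ᵀ *ᵥ y) ⬝ᵥ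
        Pm *ᵥ Sum.elim ξ ((stateNext X)ᵀ *ᵥ ξ - (regressor U X)ᵀ *ᵥ y) ≤
      lam * (ξ ⬝ᵥ Q *ᵥ ξ) - β * (ξ ⬝ᵥ ξ) + 2 * (z ⬝ᵥ fromCols Q Lᵀ *ᵥ y) + z ⬝ᵥ Q *ᵥ z := by
  have hd : (designMatrix lam β Q L).IsSymm := by
    simp [IsSymm, designMatrix, fromBlocks_transpose, hQ.eq, transpose_fromRows,
      transpose_fromCols]
  rw [SatisfiesLMI, posSemidef_iff_forall (hd.sub (isSymm_mul_mul_transpose _ hPm))]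
  have hvec : ∀ (ξ : Fin n → ℝ) (y : Fin n ⊕ Fin m → ℝ) (z : Fin n → ℝ),
      (dataMatrix U X)ᵀ *ᵥ Sum.elim (Sum.elim ξ y) z =
        Sum.elim ξ ((stateNext X)ᵀ *ᵥ ξ - (regressor U X)ᵀ *ᵥ y) := by
    intro ξ y z
    have : fromRows (-statePast X) (-U) = -regressor U X := by
      ext (i | i) j <;> simp [regressor]
    simp [dataMatrix, transpose_fromRows, fromCols_mulVec, fromBlocks_transpose,
      fromBlocks_mulVec, this, sub_eq_add_neg, neg_mulVec]
  have hform : ∀ (ξ : Fin n → ℝ) (y : Fin n ⊕ Fin m → ℝ) (z : Fin n → ℝ),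
      Sum.elim (Sum.elim ξ y) z ⬝ᵥ designMatrix lam β Q L *ᵥ Sum.elim (Sum.elim ξ y) z =
      lam * (ξ ⬝ᵥ Q *ᵥ ξ) - β * (ξ ⬝ᵥ ξ) + 2 * (z ⬝ᵥ fromCols Q Lᵀ *ᵥ y) + z ⬝ᵥ Q *ᵥ z := by
    intro ξ y z
    have h1 : y ⬝ᵥ fromRows Q L *ᵥ z = z ⬝ᵥ fromCols Q Lᵀ *ᵥ y := by
      have : fromRows Q L = (fromCols Q Lᵀ)ᵀ := by simp [transpose_fromCols, hQ.eq]
      rw [this, dotProduct_transpose_mulVec]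
    simp only [designMatrix]
    generalize fromRows Q L = G at h1 ⊢
    generalize fromCols Q Lᵀ = G' at h1 ⊢
    simp only [fromBlocks_mulVec, sumElim_dotProduct_sumElim, fromRows_mulVec, fromCols_mulVec,
      Sum.elim_comp_inl, Sum.elim_comp_inr, zero_mulVec, add_zero, zero_add, dotProduct_add,
      dotProduct_zero, sub_mulVec, smul_mulVec, one_mulVec, dotProduct_sub, dotProduct_smul,
      smul_eq_mul, h1]
    ring
  constructor
  · intro h ξ y z
    have := h (Sum.elim (Sum.elim ξ y) z)
    rwa [sub_mulVec, dotProduct_sub, dotProduct_mul_mul_transpose_mulVec, hvec, hform,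
      sub_nonneg] at this
  · intro h v
    have hv : v = Sum.elim (Sum.elim (v ∘ Sum.inl ∘ Sum.inl) (v ∘ Sum.inl ∘ Sum.inr))
        (v ∘ Sum.inr) := by
      ext ((i | i) | i) <;> rfl
    rw [hv, sub_mulVec, dotProduct_sub, dotProduct_mul_mul_transpose_mulVec, hvec, hform,
      sub_nonneg]
    exact h _ _ _

/-! ### The linear matrix inequality and uniform stabilization -/

theorem closedLoop_transpose (A : Matrix (Fin n) (Fin n) ℝ) (B : Matrix (Fin n) (Fin m) ℝ)
    (K : Matrix (Fin m) (Fin n) ℝ) :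
    (A + B * K)ᵀ = fromCols (1 : Matrix (Fin n) (Fin n) ℝ) Kᵀ * (fromCols A B)ᵀ := by
  rw [transpose_fromCols, fromCols_mul_fromRows, Matrix.one_mul, transpose_add, transpose_mul]

theorem fromCols_one_mul (Q : Matrix (Fin n) (Fin n) ℝ) (hQ : Q.IsSymm)
    (K : Matrix (Fin m) (Fin n) ℝ) :
    fromCols Q (K * Q)ᵀ = Q * fromCols (1 : Matrix (Fin n) (Fin n) ℝ) Kᵀ := by
  rw [mul_fromCols, Matrix.mul_one, transpose_mul, hQ.eq]

/-- A solution of the linear matrix inequality yields a common Lyapunov matrix: the inequality is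
evaluated at `(ξ, [A B]ᵀ ξ, -(A + B K)ᵀ ξ)`, where the data term is the noise form at `ξ`. -/
theorem uniformlyStabilizes_of_satisfiesLMI {Pm : Matrix (Fin n ⊕ Fin T) (Fin n ⊕ Fin T) ℝ}
    (hPm : Pm.IsSymm) {U : Matrix (Fin m) (Fin T) ℝ} {X : Matrix (Fin n) (Fin (T + 1)) ℝ}
    {lam β : ℝ} (hlam : 0 < lam) {Q : Matrix (Fin n) (Fin n) ℝ} (hQ : Q.PosDef)
    {L : Matrix (Fin m) (Fin n) ℝ} (hβ : 0 < β) (h : SatisfiesLMI Pm U X lam Q L β) :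
    UniformlyStabilizes Pm U X lam (L * Q⁻¹) Q⁻¹ := by
  have hQs := isSymm_of_isHermitian hQ.1
  have hu : IsUnit Q.det := (isUnit_iff_isUnit_det _).1 hQ.isUnit
  intro A B hAB
  refine posDef_inv_of_posDef hQ hlam ((posDef_smul_sub_iff hQs lam).2 fun ξ hξ => ?_)
  have h1 := (mem_consistentSystems_iff hPm).1 hAB ξ
  set K := L * Q⁻¹ with hK
  have hL : L = K * Q := by rw [hK, Matrix.mul_assoc, nonsing_inv_mul _ hu, Matrix.mul_one]
  rw [hL] at h
  have h2 := (satisfiesLMI_iff hPm U X lam β hQs (K * Q)).1 h ξ ((fromCols A B)ᵀ *ᵥ ξ)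
    (-((A + B * K)ᵀ *ᵥ ξ))
  rw [fromCols_one_mul Q hQs, mulVec_mulVec _ (Q * _), Matrix.mul_assoc Q,
    ← closedLoop_transpose, ← mulVec_mulVec _ Q, mulVec_neg, neg_dotProduct,
    neg_dotProduct_neg] at h2
  have h3 : 0 < ξ ⬝ᵥ ξ := by
    simpa using (posDef_iff_forall (isSymm_one (n := Fin n) (α := ℝ))).1 PosDef.one ξ hξ
  nlinarith [mul_pos hβ h3]

/-- Directions of `[A B]` that the data do not see are annihilated by the closed loop, since moving
along them keeps the system consistent while the closed loop stays bounded. -/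
theorem mulVec_eq_zero_of_regressor {Pm : Matrix (Fin n ⊕ Fin T) (Fin n ⊕ Fin T) ℝ}
    (hPm : Pm.IsSymm) {U : Matrix (Fin m) (Fin T) ℝ} {X : Matrix (Fin n) (Fin (T + 1)) ℝ}
    {Q : Matrix (Fin n) (Fin n) ℝ} (hQ : Q.PosDef) {C : Matrix (Fin n) (Fin n ⊕ Fin m) ℝ}
    {lam : ℝ} (hlam : lam < 1)
    {A : Matrix (Fin n) (Fin n) ℝ} {B : Matrix (Fin n) (Fin m) ℝ}
    (hAB : (A, B) ∈ consistentSystems Pm U X)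
    (hst : ∀ A B, (A, B) ∈ consistentSystems Pm U X → ∀ ξ, ξ ≠ 0 →
      (C *ᵥ ((fromCols A B)ᵀ *ᵥ ξ)) ⬝ᵥ Q *ᵥ (C *ᵥ ((fromCols A B)ᵀ *ᵥ ξ)) < lam * (ξ ⬝ᵥ Q *ᵥ ξ))
    {y : Fin n ⊕ Fin m → ℝ} (hy : (regressor U X)ᵀ *ᵥ y = 0) : C *ᵥ y = 0 := by
  by_contra hc
  set c := C *ᵥ y with hcdef
  set u := C *ᵥ ((fromCols A B)ᵀ *ᵥ c) with hu
  have hQs := isSymm_of_isHermitian hQ.1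
  have hcc : c ⬝ᵥ c ≠ 0 := by simpa using hc
  -- moving `[A B]` by `s c yᵀ` changes the closed loop at `c` by a multiple of `c` itself
  have key : ∀ s : ℝ, (u + s • c) ⬝ᵥ Q *ᵥ (u + s • c) < lam * (c ⬝ᵥ Q *ᵥ c) := by
    intro s
    set S := fromCols A B + vecMulVec ((s / (c ⬝ᵥ c)) • c) y with hS
    have hSt : ∀ ξ, Sᵀ *ᵥ ξ = (fromCols A B)ᵀ *ᵥ ξ + (s / (c ⬝ᵥ c) * (c ⬝ᵥ ξ)) • y := by
      intro ξ
      rw [hS, transpose_add, add_mulVec, transpose_vecMulVec, vecMulVec_mulVec, op_smul_eq_smul,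
        smul_dotProduct, smul_eq_mul]
    have hcols : fromCols S.toCols₁ S.toCols₂ = S := fromCols_toCols S
    have h1 : (S.toCols₁, S.toCols₂) ∈ consistentSystems Pm U X := by
      rw [mem_consistentSystems_iff hPm, hcols]
      intro ξ
      rw [hSt, mulVec_add, mulVec_smul, hy, smul_zero, add_zero]
      exact (mem_consistentSystems_iff hPm).1 hAB ξ
    have h2 := hst _ _ h1 c hc
    rw [hcols, hSt, mulVec_add, mulVec_smul, ← hcdef, ← hu, div_mul_cancel₀ _ hcc] at h2
    exact h2
  -- adding the bounds for `s = 1` and `s = -1` cancels the cross terms and leaves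
  -- `2 uᵀ Q u + 2 cᵀ Q c < 2 lam cᵀ Q c`, against `lam < 1`
  have h1 := key 1
  have h2 := key (-1)
  have h3 := (posDef_iff_forall hQs).1 hQ c hc
  have h4 := (posSemidef_iff_forall hQs).1 hQ.posSemidef u
  simp only [one_smul, neg_smul, ← sub_eq_add_neg, mulVec_add, mulVec_sub, dotProduct_add,
    add_dotProduct, dotProduct_sub, sub_dotProduct] at h1 h2
  nlinarith

theorem sumElim_zero_dotProduct_mulVec (Pm : Matrix (Fin n ⊕ Fin T) (Fin n ⊕ Fin T) ℝ)
    (v : Fin T → ℝ) : Sum.elim 0 v ⬝ᵥ Pm *ᵥ Sum.elim 0 v = v ⬝ᵥ Pm.toBlocks₂₂ *ᵥ v := by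
  conv_lhs => rw [← fromBlocks_toBlocks Pm]
  simp [fromBlocks_mulVec]

/-- The S-lemma certificate of uniform stabilization, in the Lyapunov matrix `Q` of the dual
inequality and the map `C`, which is `[I Kᵀ]` in the application. The forms live on pairs `(ξ, r)`,
where `r` is the image under `[X₋; U₋]ᵀ` of the deviation of `y` from the true `[A B]ᵀ ξ`. -/
theorem exists_multiplier {Pm : Matrix (Fin n ⊕ Fin T) (Fin n ⊕ Fin T) ℝ}
    (hPm : IsNoiseModel Pm) {U : Matrix (Fin m) (Fin T) ℝ} {X : Matrix (Fin n) (Fin (T + 1)) ℝ}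
    {Q : Matrix (Fin n) (Fin n) ℝ} (hQ : Q.PosDef) {C : Matrix (Fin n) (Fin n ⊕ Fin m) ℝ}
    {lam : ℝ} (hlam : lam < 1)
    {A : Matrix (Fin n) (Fin n) ℝ} {B : Matrix (Fin n) (Fin m) ℝ}
    (hAB : (A, B) ∈ consistentSystems Pm U X)
    (hst : ∀ A B, (A, B) ∈ consistentSystems Pm U X → ∀ ξ, ξ ≠ 0 →
      (C *ᵥ ((fromCols A B)ᵀ *ᵥ ξ)) ⬝ᵥ Q *ᵥ (C *ᵥ ((fromCols A B)ᵀ *ᵥ ξ)) < lam * (ξ ⬝ᵥ Q *ᵥ ξ)) :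
    ∃ α : ℝ, 0 < α ∧ ∃ c : ℝ, 0 < c ∧ ∀ ξ y,
      α * (Sum.elim ξ ((stateNext X)ᵀ *ᵥ ξ - (regressor U X)ᵀ *ᵥ y) ⬝ᵥ
        Pm *ᵥ Sum.elim ξ ((stateNext X)ᵀ *ᵥ ξ - (regressor U X)ᵀ *ᵥ y)) + c * ‖ξ‖ ^ 2 ≤
      lam * (ξ ⬝ᵥ Q *ᵥ ξ) - (C *ᵥ y) ⬝ᵥ Q *ᵥ (C *ᵥ y) := by
  have hQs := isSymm_of_isHermitian hQ.1
  set D := regressor U X with hD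
  let R : Submodule ℝ (Fin T → ℝ) := LinearMap.range Dᵀ.mulVecLin
  -- a linear section `σ` of `[X₋; U₋]ᵀ` onto its range; `C ∘ σ` does not depend on its choice
  obtain ⟨σ, hσ⟩ := Dᵀ.mulVecLin.rangeRestrict.exists_rightInverse_of_surjective
    (LinearMap.range_rangeRestrict _)
  have hσ' : ∀ r : R, Dᵀ *ᵥ σ r = r := fun r =>
    congrArg Subtype.val (LinearMap.congr_fun hσ r)
  have hker : ∀ (y : Fin n ⊕ Fin m → ℝ) (r : R), Dᵀ *ᵥ y = r → C *ᵥ σ r = C *ᵥ y := by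
    intro y r hr
    have := mulVec_eq_zero_of_regressor hPm.symm hQ hlam hAB hst (y := σ r - y)
      (by rw [mulVec_sub, hσ', ← hr, sub_self])
    rwa [mulVec_sub, sub_eq_zero] at this
  set S := fromCols A B with hS
  -- `φ (ξ, r)` is `ξ` with the noise `Wᵀ ξ` that a deviation `r` entails, and `ψ (ξ, r)` is the
  -- value of `C` at the corresponding `y`
  let φ : ((Fin n → ℝ) × R) →ₗ[ℝ] (Fin n ⊕ Fin T → ℝ) :=
    { toFun := fun p => Sum.elim p.1 ((stateNext X)ᵀ *ᵥ p.1 - Dᵀ *ᵥ (Sᵀ *ᵥ p.1) - p.2)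
      map_add' := fun p q => by
        ext (i | i)
        · simp
        · simp [mulVec_add]; ring
      map_smul' := fun a p => by
        ext (i | i)
        · simp
        · simp [mulVec_smul]; ring }
  let ψ : ((Fin n → ℝ) × R) →ₗ[ℝ] (Fin n → ℝ) :=
    (C * Sᵀ).mulVecLin ∘ₗ LinearMap.fst ℝ _ _ + C.mulVecLin ∘ₗ σ ∘ₗ LinearMap.snd ℝ _ _
  let N : LinearMap.BilinForm ℝ ((Fin n → ℝ) × R) := (toBilin' Pm).compl₁₂ φ φ
  let M : LinearMap.BilinForm ℝ ((Fin n → ℝ) × R) :=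
    lam • (toBilin' Q).compl₁₂ (LinearMap.fst ℝ _ _) (LinearMap.fst ℝ _ _)
      - (toBilin' Q).compl₁₂ ψ ψ
  have hN : ∀ p, N p p = φ p ⬝ᵥ Pm *ᵥ φ p := fun p => by simp [N, toBilin'_apply']
  have hM : ∀ p, M p p = lam * (p.1 ⬝ᵥ Q *ᵥ p.1) - ψ p ⬝ᵥ Q *ᵥ ψ p := fun p => by
    simp [M, toBilin'_apply']
  have hψ : ∀ ξ r, ψ (ξ, r) = C *ᵥ (Sᵀ *ᵥ ξ) + C *ᵥ σ r := fun ξ r => by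
    rw [mulVec_mulVec]; rfl
  have hNs : N.IsSymm := ⟨fun p q => (toBilin'_isSymm hPm.symm).eq (φ p) (φ q)⟩
  have hMs : M.IsSymm := ⟨fun p q => by
    have h1 := (toBilin'_isSymm hQs).eq p.1 q.1
    have h2 := (toBilin'_isSymm hQs).eq (ψ p) (ψ q)
    simp [M, h1, h2]⟩
  have hpos : ∀ ξ, 0 ≤ N (ξ, 0) (ξ, 0) := fun ξ => by
    rw [hN]
    simpa [φ] using (mem_consistentSystems_iff hPm.symm).1 hAB ξ
  have hneg : ∀ r, r ≠ 0 → N (0, r) (0, r) < 0 := fun r hr => by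
    have h1 := (posDef_iff_forall (isSymm_of_isHermitian hPm.neg.1)).1 hPm.neg (-(r : Fin T → ℝ))
      (by simpa using hr)
    rw [neg_mulVec, dotProduct_neg, ← sumElim_zero_dotProduct_mulVec] at h1
    rw [hN]
    simpa [φ] using h1
  have himp : ∀ p, p ≠ 0 → 0 ≤ N p p → 0 < M p p := by
    rintro ⟨ξ, r⟩ hp hNp
    have hξ : ξ ≠ 0 := by
      rintro rfl
      exact absurd (hneg r fun hr => hp (by simp [hr])) hNp.not_gt
    -- a consistent system whose regressor at `ξ` is the prescribed one
    obtain ⟨h, hh, hpos'⟩ := exists_linearMap_interpolating hNs hpos hneg hNp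
    let S' := S + (LinearMap.toMatrix' (σ ∘ₗ h))ᵀ
    have hS' : ∀ η, S'ᵀ *ᵥ η = Sᵀ *ᵥ η + σ (h η) := fun η => by
      simp only [S', transpose_add, transpose_transpose, add_mulVec, LinearMap.toMatrix'_mulVec,
        LinearMap.comp_apply]
    have hcols : fromCols S'.toCols₁ S'.toCols₂ = S' := fromCols_toCols S'
    have h1 : (S'.toCols₁, S'.toCols₂) ∈ consistentSystems Pm U X := by
      rw [mem_consistentSystems_iff hPm.symm, hcols]
      intro η
      have := hpos' η
      rw [hN] at this
      rw [hS', ← hD, mulVec_add, hσ', ← sub_sub]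
      exact this
    have h2 := hst _ _ h1 ξ hξ
    rw [hcols, hS', hh] at h2
    rwa [hM, sub_pos, hψ, ← mulVec_add]
  obtain ⟨α, hα, c, hc, hαc⟩ := strict_S_lemma hMs hNs himp
  refine ⟨α, hα, c, hc, fun ξ y => ?_⟩
  let r : R := ⟨Dᵀ *ᵥ (y - Sᵀ *ᵥ ξ), LinearMap.mem_range_self Dᵀ.mulVecLin _⟩
  have h1 := hαc (ξ, r)
  have hφ : φ (ξ, r) = Sum.elim ξ ((stateNext X)ᵀ *ᵥ ξ - Dᵀ *ᵥ y) := by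
    simp only [φ, r, LinearMap.coe_mk, AddHom.coe_mk, mulVec_sub]
    congr 1
    abel
  have hψr : ψ (ξ, r) = C *ᵥ y := by
    rw [hψ, hker (y - Sᵀ *ᵥ ξ) r rfl, mulVec_sub, add_sub_cancel]
  rw [hN, hM, hφ, hψr] at h1
  have h2 : ‖ξ‖ ^ 2 ≤ ‖(ξ, r)‖ ^ 2 := by
    gcongr
    exact norm_fst_le (ξ, r)
  have h3 := mul_le_mul_of_nonneg_left h2 hc.le
  simp only at h1
  linarith

theorem dotProduct_self_le_card_mul_norm_sq (ξ : Fin n → ℝ) : ξ ⬝ᵥ ξ ≤ n * ‖ξ‖ ^ 2 := by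
  have h : ∀ i ∈ Finset.univ, ξ i * ξ i ≤ ‖ξ‖ ^ 2 := fun i _ => by
    have := norm_le_pi_norm ξ i
    rw [← sq, ← sq_abs, ← Real.norm_eq_abs]
    gcongr
  simpa [dotProduct] using Finset.sum_le_card_nsmul _ _ _ h

/-- Necessity of the linear matrix inequality: the multiplier of the S-lemma is normalized to `1`
by scaling `Q`. -/
theorem exists_satisfiesLMI_of_informative {Pm : Matrix (Fin n ⊕ Fin T) (Fin n ⊕ Fin T) ℝ}
    (hPm : IsNoiseModel Pm) {U : Matrix (Fin m) (Fin T) ℝ} {X : Matrix (Fin n) (Fin (T + 1)) ℝ}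
    {lam : ℝ} (hlam : lam ∈ Set.Ioo (0 : ℝ) 1)
    {A : Matrix (Fin n) (Fin n) ℝ} {B : Matrix (Fin n) (Fin m) ℝ}
    (hAB : (A, B) ∈ consistentSystems Pm U X)
    (h : InformativeForUniformStabilization Pm U X lam) :
    ∃ (Q : Matrix (Fin n) (Fin n) ℝ) (L : Matrix (Fin m) (Fin n) ℝ) (β : ℝ),
      Q.PosDef ∧ 0 < β ∧ SatisfiesLMI Pm U X lam Q L β := by
  obtain ⟨K, P, hP, hKP⟩ := h
  have hst : ∀ A B, (A, B) ∈ consistentSystems Pm U X → ∀ ξ, ξ ≠ 0 →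
      (fromCols (1 : Matrix (Fin n) (Fin n) ℝ) Kᵀ *ᵥ ((fromCols A B)ᵀ *ᵥ ξ)) ⬝ᵥ
        P⁻¹ *ᵥ (fromCols (1 : Matrix (Fin n) (Fin n) ℝ) Kᵀ *ᵥ ((fromCols A B)ᵀ *ᵥ ξ)) <
        lam * (ξ ⬝ᵥ P⁻¹ *ᵥ ξ) := by
    intro A B hAB
    have h1 := hKP A B hAB
    -- the first factor has to read as the transpose of `(A + B * K)ᵀ` for the duality lemma
    rw [← transpose_transpose (A + B * K), transpose_transpose (A + B * K)ᵀ] at h1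
    have h2 := posDef_inv_of_posDef (A := (A + B * K)ᵀ) hP hlam.1 h1
    rw [transpose_transpose,
      posDef_smul_sub_iff (isSymm_of_isHermitian hP.inv.1), closedLoop_transpose] at h2
    simpa only [mulVec_mulVec] using h2
  obtain ⟨α, hα, c, hc, hαc⟩ := exists_multiplier hPm hP.inv hlam.2 hAB hst
  have hQ : (α⁻¹ • P⁻¹).PosDef := hP.inv.smul (inv_pos.2 hα)
  have hQs := isSymm_of_isHermitian hQ.1
  refine ⟨α⁻¹ • P⁻¹, K * (α⁻¹ • P⁻¹), c / (α * (n + 1)), hQ, by positivity, ?_⟩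
  rw [satisfiesLMI_iff hPm.symm _ _ _ _ hQs]
  intro ξ y z
  have h1 := hαc ξ y
  rw [fromCols_one_mul _ hQs, ← mulVec_mulVec]
  set w := fromCols (1 : Matrix (Fin n) (Fin n) ℝ) Kᵀ *ᵥ y with hw
  set q := Sum.elim ξ ((stateNext X)ᵀ *ᵥ ξ - (regressor U X)ᵀ *ᵥ y) ⬝ᵥ
        Pm *ᵥ Sum.elim ξ ((stateNext X)ᵀ *ᵥ ξ - (regressor U X)ᵀ *ᵥ y)
  -- the terms in `z` complete to the square `(z + w)ᵀ Q (z + w)`, up to `-wᵀ Q w`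
  have hsq := (posSemidef_iff_forall hQs).1 hQ.posSemidef (z + w)
  have hcomm := dotProduct_mulVec_comm hQs w z
  simp only [mulVec_add, dotProduct_add, add_dotProduct] at hsq
  have h2 : q + c / α * ‖ξ‖ ^ 2 ≤
      lam * (ξ ⬝ᵥ (α⁻¹ • P⁻¹) *ᵥ ξ) - w ⬝ᵥ (α⁻¹ • P⁻¹) *ᵥ w := by
    have h3 := mul_le_mul_of_nonneg_left h1 (inv_pos.2 hα).le
    simp only [smul_mulVec, dotProduct_smul, smul_eq_mul]
    calc q + c / α * ‖ξ‖ ^ 2 = α⁻¹ * (α * q + c * ‖ξ‖ ^ 2) := by field_simp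
      _ ≤ _ := h3
      _ = _ := by ring
  -- `n + 1` keeps the denominator of `β` nonzero when `n = 0`
  have h4 : c / (α * (n + 1)) * (ξ ⬝ᵥ ξ) ≤ c / α * ‖ξ‖ ^ 2 := by
    have h5 : ξ ⬝ᵥ ξ ≤ (n + 1) * ‖ξ‖ ^ 2 :=
      (dotProduct_self_le_card_mul_norm_sq ξ).trans (by nlinarith [sq_nonneg ‖ξ‖])
    calc c / (α * (n + 1)) * (ξ ⬝ᵥ ξ) ≤ c / (α * (n + 1)) * ((n + 1) * ‖ξ‖ ^ 2) := by gcongr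
      _ = _ := by field_simp
  linarith

end DataDriven

theorem mainTheorem2 (n m T : ℕ)
    (Pm : Matrix (Fin n ⊕ Fin T) (Fin n ⊕ Fin T) ℝ) (hPm : DataDriven.IsNoiseModel Pm)
    (U : Matrix (Fin m) (Fin T) ℝ) (X : Matrix (Fin n) (Fin (T + 1)) ℝ)
    -- the data is generated by some true system with noise that obeys the noise model
    (Ahat : Matrix (Fin n) (Fin n) ℝ) (Bhat : Matrix (Fin n) (Fin m) ℝ)
    (htrue : (Ahat, Bhat) ∈ DataDriven.consistentSystems Pm U X)
    (lam : ℝ) (hlam : lam ∈ Set.Ioo (0 : ℝ) 1) :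
    (DataDriven.InformativeForUniformStabilization Pm U X lam ↔
      ∃ (Q : Matrix (Fin n) (Fin n) ℝ) (L : Matrix (Fin m) (Fin n) ℝ) (β : ℝ),
        Q.PosDef ∧ 0 < β ∧ DataDriven.SatisfiesLMI Pm U X lam Q L β) ∧
    (∀ (Q : Matrix (Fin n) (Fin n) ℝ) (L : Matrix (Fin m) (Fin n) ℝ) (β : ℝ),
        Q.PosDef → 0 < β → DataDriven.SatisfiesLMI Pm U X lam Q L β →
          Q⁻¹.PosDef ∧ DataDriven.UniformlyStabilizes Pm U X lam (L * Q⁻¹) Q⁻¹) := by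
  have hsuff : ∀ (Q : Matrix (Fin n) (Fin n) ℝ) (L : Matrix (Fin m) (Fin n) ℝ) (β : ℝ),
      Q.PosDef → 0 < β → DataDriven.SatisfiesLMI Pm U X lam Q L β →
        Q⁻¹.PosDef ∧ DataDriven.UniformlyStabilizes Pm U X lam (L * Q⁻¹) Q⁻¹ :=
    fun Q L β hQ hβ h =>
      ⟨hQ.inv, DataDriven.uniformlyStabilizes_of_satisfiesLMI hPm.symm hlam.1 hQ hβ h⟩
  refine ⟨⟨DataDriven.exists_satisfiesLMI_of_informative hPm hlam htrue, ?_⟩, hsuff⟩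
  rintro ⟨Q, L, β, hQ, hβ, h⟩
  exact ⟨L * Q⁻¹, Q⁻¹, hsuff Q L β hQ hβ h⟩
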